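/- Throughout, faces of a polytope are nonempty (the polytope itself is one of its faces), $\mathcal F(P)$ is the set of faces of $P$, and simplices are given with their vertices. Let $P\subset\mathbb R^e$ be a nonempty polytope of dimension $d$. A \emph{pointed triangulation} of $P$ is a finite triangulation $\mathcal C_P$ of $P$ (a finite geometric simplicial complex with underlying set $P$) together with a vertex $\mathbf v_F$ of $F$, called the \emph{apex} of $F$, for each face $F$ of $P$, such that, with $\mathcal C_F=\{\sigma\in\mathcal C_P : \sigma\subseteq F\}$: (1) for each $k$-face $F$ of $P$, $\mathcal C_F$ is a triangulation of $F$ and $\mathbf v_F$ lies in every $k$-simplex of $\mathcal C_F$; (2) for all faces $F_1,F_2$ of $P$, if $\{\mathbf v_{F_1},\mathbf v_{F_2}\}\subseteq F_1\cap F_2$, then $\mathbf v_{F_1}=\mathbf v_{F_2}$; (3) for each face $F$ of $P$ and each vertex $\mathbf w\ne\mathbf v_F$ of $F$, the segment $\operatorname{conv}\{\mathbf v_F,\mathbf w\}$ is a simplex of $\mathcal C_F$. With $V(P)=\{\mathbf v_F : F\in\mathcal F(P)\}$, $\mathcal C_P$ is called a $V(P)$-pointed triangulation. For a polytope $Q$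 with a chosen vertex $\mathbf v_F$ for each face $F$ of $Q$, the \emph{polytope numbers} $Q(n)$ and the \emph{interior polytope numbers} $Q(n)^\sharp$, $n\ge 0$, are defined by induction on $\dim Q$ and $n$. If $\dim Q=0$, then $Q(0)=Q(0)^\sharp=0$ and $Q(n)=Q(n)^\sharp=1$ for $n\ge1$. If $\dim Q\ge1$, then $Q(0)=Q(0)^\sharp=0$, $Q(1)=1$, $Q(1)^\sharp=0$, and for $n\ge2$ $$Q(n)=Q(n-1)+\sum_{F\in\mathcal F(Q),\ \mathbf v_Q\notin F}F(n)^\sharp,\qquad Q(n)^\sharp=Q(n)-\sum_{F\in\mathcal F(Q)\setminus\{Q\}}F(n)^\sharp .$$ Let $\alpha^k(n)$ be the polytope numbers of the standard $k$-simplex $\operatorname{conv}\{\mathbf e_1,\dots,\mathbf e_{k+1}\}\subset\mathbb R^{k+1}$, where the apex of each face is the point of the face at which the linear function $\sum_{i=1}^{k+1} i\,x_i$ is minimal; put $\alpha^k(m)=0$ for integers $m\le 0$. \textbf{Theorem (Decomposition theorem 3-1).} Let $\mathcal C_P$ be a $V(P)$-pointed triangulation of $P$ and let $P(n)$ be the polytope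 numbers of $P$ for the apexes $\mathbf v_F$. Then for all $n\ge 0$ $$P(n)=\sum_{k=0}^{d}c_k\,\alpha^k(n-k),$$ where $c_k$ is the number of $k$-simplices of $\mathcal C_P$ that contain the apex $\mathbf v_P$ of $P$. -/

import Mathlib

namespace PolytopeNumbers

noncomputable section

section General

variable {E : Type*} [NormedAddCommGroup E] [NormedSpace ℝ E]

/-- A polytope: the convex hull of a finite set of points. -/
def IsPolytope (P : Set E) : Prop :=
  ∃ s : Set E, s.Finite ∧ P = convexHull ℝ s

/-- `F` is a nonempty face of `P`: either `P` itself or the intersection of `P` with a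
supporting hyperplane. -/
def IsFace (P F : Set E) : Prop :=
  F.Nonempty ∧ IsExposed ℝ P F

/-- The dimension of the affine hull of `P`. -/
def dim (P : Set E) : ℕ :=
  Module.finrank ℝ (vectorSpan ℝ P)

/-- A proper face has smaller dimension. -/
theorem dim_lt_of_isFace [FiniteDimensional ℝ E] {P F : Set E}
    (hF : IsFace P F) (hne : F ≠ P) : dim F < dim P := by
  obtain ⟨⟨x, hx⟩, hexp⟩ := hF
  obtain ⟨l, hl⟩ := hexp ⟨x, hx⟩
  have hsub : F ⊆ P := by
    rw [hl]
    exact fun y hy => hy.1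
  obtain ⟨y, hyP, hyF⟩ : ∃ y ∈ P, y ∉ F := by
    by_contra h
    push Not at h
    exact hne (Set.Subset.antisymm hsub h)
  have hmax : ∀ u ∈ F, ∀ w ∈ P, l w ≤ l u := by
    intro u hu
    rw [hl] at hu
    exact hu.2
  have hker : vectorSpan ℝ F ≤ LinearMap.ker l.toLinearMap := by
    rw [vectorSpan_def, Submodule.span_le]
    rintro _ ⟨a, ha, b, hb, rfl⟩
    have h1 := hmax a ha b (hsub hb)
    have h2 := hmax b hb a (hsub ha)
    have h3 : l a = l b := le_antisymm h2 h1
    simp [h3]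
  have hylt : l y < l x := by
    rcases lt_or_eq_of_le (hmax x hx y hyP) with h | h
    · exact h
    · exact absurd (by rw [hl]; exact ⟨hyP, fun w hw => h ▸ hmax x hx w hw⟩) hyF
  refine Submodule.finrank_lt_finrank_of_lt (lt_of_le_of_ne (vectorSpan_mono ℝ hsub) ?_)
  intro heq
  have hmem : y - x ∈ vectorSpan ℝ F := by
    rw [heq]
    exact vsub_mem_vectorSpan ℝ hyP (hsub hx)
  have h0 : l (y - x) = 0 := by
    simpa using hker hmem
  rw [map_sub] at h0
  linarith

mutual

/-- The polytope numbers `P(n)` of the polytope `P`, where `v F` is the apex chosen for the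
face `F`. Since the apex of `P` belongs to `P`, the sum runs over all the faces of `P` that do
not contain the apex of `P`. -/
def polytopeNumber [FiniteDimensional ℝ E] (v : Set E → E) (P : Set E) (n : ℕ) : ℤ :=
  match n with
  | 0 => 0
  | 1 => 1
  | m + 2 =>
    if dim P = 0 then 1
    else polytopeNumber v P (m + 1) +
      ∑ᶠ F : {F : Set E // (IsFace P F ∧ F ≠ P) ∧ v P ∉ F}, interiorNumber v F.1 (m + 2)
termination_by (dim P, n, 0)
decreasing_by
  · exact Prod.Lex.right _ (Prod.Lex.left _ _ (by omega))
  · exact Prod.Lex.left _ _ (dim_lt_of_isFace F.2.1.1 F.2.1.2)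

/-- The interior polytope numbers `P(n)♯` of the polytope `P`, where `v F` is the apex chosen
for the face `F`. -/
def interiorNumber [FiniteDimensional ℝ E] (v : Set E → E) (P : Set E) (n : ℕ) : ℤ :=
  if dim P = 0 then (if n = 0 then 0 else 1)
  else if n ≤ 1 then 0
  else polytopeNumber v P n -
    ∑ᶠ F : {F : Set E // IsFace P F ∧ F ≠ P}, interiorNumber v F.1 n
termination_by (dim P, n, 1)
decreasing_by
  · exact Prod.Lex.right _ (Prod.Lex.right _ (by omega))
  · exact Prod.Lex.left _ _ (dim_lt_of_isFace F.2.1 F.2.2)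

end

/-- The simplices of `C` contained in `F`. -/
def restrictFaces (C : Geometry.SimplicialComplex ℝ E) (F : Set E) : Set (Finset E) :=
  {s | s ∈ C.faces ∧ convexHull ℝ (s : Set E) ⊆ F}

/-- `C` is a pointed triangulation of the polytope `P`, and `v F` is the apex of each
nonempty face `F` of `P`. A simplex is represented by the finite set of its vertices. -/
structure IsPointedTriangulation (P : Set E) (C : Geometry.SimplicialComplex ℝ E)
    (v : Set E → E) : Prop where
  finite : C.faces.Finite
  space_eq : C.space = P
  /-- each face is triangulated by the simplices of `C` that it contains -/
  triangulates : ∀ F, IsFace P F → ⋃ s ∈ restrictFaces C F, convexHull ℝ (s : Set E) = F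
  apex_mem_vertices : ∀ F, IsFace P F → v F ∈ F.extremePoints ℝ
  /-- the apex of a `k`-face lies in all the `k`-simplices of the triangulation of that face -/
  apex_mem_simplex : ∀ F, IsFace P F → ∀ s ∈ restrictFaces C F,
    s.card = dim F + 1 → v F ∈ convexHull ℝ (s : Set E)
  apex_coherent : ∀ F₁ F₂, IsFace P F₁ → IsFace P F₂ →
    v F₁ ∈ F₁ ∩ F₂ → v F₂ ∈ F₁ ∩ F₂ → v F₁ = v F₂
  edge_mem : ∀ F, IsFace P F → ∀ w ∈ F.extremePoints ℝ, w ≠ v F →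
    ∃ s ∈ restrictFaces C F, (s : Set E) = {v F, w}

/-- The set of `k`-simplices of `C` that contain the point `x`. -/
def simplicesThrough (C : Geometry.SimplicialComplex ℝ E) (x : E) (k : ℕ) :
    Set (Finset E) :=
  {s | s ∈ C.faces ∧ s.card = k + 1 ∧ x ∈ convexHull ℝ (s : Set E)}

end General

/-- The standard `k`-simplex, the convex hull of the unit vectors of `ℝ^(k+1)`. -/
def standardSimplex (k : ℕ) : Set (EuclideanSpace ℝ (Fin (k + 1))) :=
  convexHull ℝ (Set.range fun i => EuclideanSpace.single i (1 : ℝ))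

/-- The apex of a face `F` of the standard `k`-simplex: the point of `F` where the linear
function `x ↦ ∑ i, (i + 1) * x i` is minimal. -/
def standardSimplexApex (k : ℕ) (F : Set (EuclideanSpace ℝ (Fin (k + 1)))) :
    EuclideanSpace ℝ (Fin (k + 1)) :=
  Classical.epsilon fun x =>
    x ∈ F ∧ ∀ y ∈ F, ∑ i : Fin (k + 1), (((i : ℕ) : ℝ) + 1) * x i ≤
      ∑ i : Fin (k + 1), (((i : ℕ) : ℝ) + 1) * y i

/-- The `k`-simplex numbers `α^k(m)`: the polytope numbers of the standard `k`-simplex,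
extended by `0` to negative arguments `m`. -/
def simplexNumber (k : ℕ) (m : ℤ) : ℤ :=
  polytopeNumber (standardSimplexApex k) (standardSimplex k) m.toNat

end

end PolytopeNumbers

-- Both kinds of numbers count simplices with binomial weights. For a triangulation whose
-- full-dimensional simplices of each face contain the apex of that face, $P(m+1)=\sum_{t\ni
-- v_P}\binom{m}{|t|-1}$, while $P(m+2)^\sharp$ is the sum of $\binom{m}{|t|-1}$ over the simplices
-- $t$ whose carrier (the smallest face containing them) is $P$ (`numbers_eq_sum`).
--
-- Two geometric facts carry this. The full-dimensional simplices cover $P$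
-- (`exists_top_simplex_of_mem`), so the triangulation is a cone: adding $v_P$ to a simplex gives a
-- simplex (`insert_apex_mem`). A simplex without $v_P$ has a carrier that avoids $v_P$, since a
-- segment from $v_P$ through its barycenter cannot be prolonged inside $P$ (`apex_mem_carrier_iff`,
-- resting on Farkas' lemma). By Pascal's rule and the cone structure, passing from $m$ to $m+1$ in
-- the sum over simplices with apex adds the sum over simplices without apex (`sum_choose_succ`);
-- sorted by carrier, these are the faces in the recursion.
--
-- A simplex is triangulated by its own faces, so the same formula with Vandermonde's identity gives
-- $\alpha^k(m+1)=\binom{m+k}{k}$, that is $\alpha^k(n-k)=\binom{n-1}{k}$ for $n\ge1$. Grouping the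
-- formula for $P$ by dimension yields the theorem.

namespace PolytopeNumbers

open Set Geometry

-- Farkas' lemma, faces of polytopes and carriers.

section Geometry

variable {E : Type*} [NormedAddCommGroup E] [NormedSpace ℝ E]

/-- Farkas' lemma: a vector is a nonnegative combination of finitely many vectors, or it is
separated from all of them by a linear form. -/
theorem exists_nonneg_combination_or_separating {ι V : Type*} [AddCommGroup V] [Module ℝ V]
    (s : Finset ι) :
    ∀ (f : ι → V) (b : V), (∃ w : ι → ℝ, (∀ i ∈ s, 0 ≤ w i) ∧ ∑ i ∈ s, w i • f i = b) ∨
      ∃ l : V →ₗ[ℝ] ℝ, (∀ i ∈ s, 0 ≤ l (f i)) ∧ l b < 0 := by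
  classical
  induction s using Finset.induction_on with
  | empty =>
    intro f b
    by_cases hb : b = 0
    · exact Or.inl ⟨0, by simp, by simp [hb]⟩
    · obtain ⟨l, hl⟩ : ∃ l : Module.Dual ℝ V, l b ≠ 0 := by
        by_contra! h
        exact hb ((Module.forall_dual_apply_eq_zero_iff ℝ b).1 h)
      rcases lt_or_gt_of_ne hl with h | h
      · exact Or.inr ⟨l, by simp, h⟩
      · exact Or.inr ⟨-l, by simp, by simpa using h⟩
  | insert a s ha ih =>
    intro f b
    rcases ih f b with ⟨w, hw, hwb⟩ | ⟨l', hl', hb⟩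
    · refine Or.inl ⟨fun i => if i = a then 0 else w i, ?_, ?_⟩
      · intro i hi
        by_cases h : i = a
        · simp [h]
        · simpa [h] using hw i (Finset.mem_of_mem_insert_of_ne hi h)
      · rw [Finset.sum_insert ha, ← hwb]
        simp only [if_true, zero_smul, zero_add]
        refine Finset.sum_congr rfl fun i hi => ?_
        rw [if_neg (by rintro rfl; exact ha hi)]
    by_cases hla : 0 ≤ l' (f a)
    · exact Or.inr ⟨l', by simpa [hla] using hl', hb⟩
    push Not at hla
    -- Move all vectors along `f a` into the kernel of `l'`, then apply the induction hypothesis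
    -- there.
    rcases ih (fun i => f i - (l' (f i) / l' (f a)) • f a) (b - (l' b / l' (f a)) • f a) with
      ⟨w, hw, hwb⟩ | ⟨m, hm, hmb⟩
    -- The coefficient of `f a` is nonnegative: `l' b` and `l' (f a)` are negative, and every `l' (f
    -- j)` is nonnegative.
    · refine Or.inl ⟨fun i => if i = a then
        l' b / l' (f a) - ∑ j ∈ s, w j * (l' (f j) / l' (f a)) else w i, ?_, ?_⟩
      · intro i hi
        by_cases h : i = a
        · simp only [h, if_true, sub_nonneg]
          refine le_trans (Finset.sum_nonpos fun j hj => ?_)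
            (div_nonneg_of_nonpos hb.le hla.le)
          exact mul_nonpos_of_nonneg_of_nonpos (hw j hj)
            (div_nonpos_of_nonneg_of_nonpos (hl' j hj) hla.le)
        · simpa [h] using hw i (Finset.mem_of_mem_insert_of_ne hi h)
      · rw [Finset.sum_insert ha]
        simp only [if_true]
        have h1 : ∑ i ∈ s, (if i = a then
            l' b / l' (f a) - ∑ j ∈ s, w j * (l' (f j) / l' (f a)) else w i) • f i =
            ∑ i ∈ s, w i • f i :=
          Finset.sum_congr rfl fun i hi => by rw [if_neg (by rintro rfl; exact ha hi)]
        rw [h1]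
        simp only [smul_sub, Finset.sum_sub_distrib, smul_smul, ← Finset.sum_smul] at hwb
        rw [sub_smul]
        rw [sub_eq_iff_eq_add] at hwb
        rw [hwb]
        abel
    -- This form vanishes at `f a`, and its value at `f i` or `b` is that of `m` at the moved
    -- vector.
    · refine Or.inr ⟨m - (m (f a) / l' (f a)) • l', ?_, ?_⟩
      · intro i hi
        rcases Finset.mem_insert.1 hi with rfl | hi
        · simp [hla.ne]
        · have := hm i hi
          simp only [map_sub, map_smul, smul_eq_mul, LinearMap.sub_apply,
            LinearMap.smul_apply] at this ⊢
          convert this using 2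
          ring
      · simp only [map_sub, map_smul, smul_eq_mul, LinearMap.sub_apply,
          LinearMap.smul_apply] at hmb ⊢
        convert hmb using 2
        ring

/-- A convex set covered by finitely many affine subspaces lies in one of them. -/
theorem Convex.exists_subset_of_subset_biUnion {ι : Type*} {K : Set E} (hK : Convex ℝ K)
    (hne : K.Nonempty) (s : Finset ι) (A : ι → AffineSubspace ℝ E)
    (h : K ⊆ ⋃ i ∈ s, (A i : Set E)) : ∃ i ∈ s, K ⊆ A i := by
  classical
  induction s using Finset.induction_on with
  | empty => obtain ⟨x, hx⟩ := hne; simpa using h hx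
  | insert a s ha ih =>
    by_cases h1 : K ⊆ ⋃ i ∈ s, (A i : Set E)
    · obtain ⟨i, hi, hiK⟩ := ih h1
      exact ⟨i, Finset.mem_insert_of_mem hi, hiK⟩
    by_cases h2 : K ⊆ A a
    · exact ⟨a, Finset.mem_insert_self _ _, h2⟩
    exfalso
    obtain ⟨q, hqK, hq⟩ := not_subset.1 h1
    obtain ⟨p, hpK, hp⟩ := not_subset.1 h2
    -- Pigeonhole: two of the infinitely many points of the segment from `p` to `q` share a
    -- subspace, which then contains the whole line, hence `p` and `q`.
    have hcov : ∀ t : Set.Icc (0 : ℝ) 1, ∃ i : {i // i ∈ insert a s},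
        AffineMap.lineMap p q (t : ℝ) ∈ A i := by
      intro t
      have := h (hK.lineMap_mem hpK hqK t.2)
      simp only [mem_iUnion] at this
      obtain ⟨i, hi, hm⟩ := this
      exact ⟨⟨i, hi⟩, hm⟩
    choose g hg using hcov
    have : Infinite (Set.Icc (0 : ℝ) 1) := (Set.Icc_infinite zero_lt_one).to_subtype
    obtain ⟨t, u, htu, hgtu⟩ := Finite.exists_ne_map_eq_of_infinite g
    have ht := hg t
    have hu := hg u
    rw [← hgtu] at hu
    have htu' : (u : ℝ) - t ≠ 0 := fun h => htu (Subtype.ext (by linarith))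
    have hall : ∀ r : ℝ, AffineMap.lineMap p q r ∈ A (g t) := by
      intro r
      have := AffineMap.lineMap_mem ((r - t) / (u - t)) ht hu
      convert this using 1
      rw [← AffineMap.apply_lineMap (AffineMap.lineMap p q : ℝ →ᵃ[ℝ] E)]
      congr 1
      simp [AffineMap.lineMap_apply]
      field_simp
      ring
    have hp' := hall 0
    have hq' := hall 1
    simp only [AffineMap.lineMap_apply_zero, AffineMap.lineMap_apply_one] at hp' hq'
    rcases Finset.mem_insert.1 (g t).2 with he | he
    · exact hp (he ▸ hp')
    · exact hq (mem_biUnion he hq')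


theorem IsPolytope.convex {P : Set E} (hP : IsPolytope P) : Convex ℝ P := by
  obtain ⟨s, -, rfl⟩ := hP
  exact convex_convexHull ℝ s

theorem IsPolytope.isCompact {P : Set E} (hP : IsPolytope P) : IsCompact P := by
  obtain ⟨s, hs, rfl⟩ := hP
  exact hs.isCompact_convexHull ℝ

theorem IsFace.subset {P F : Set E} (h : IsFace P F) : F ⊆ P := h.2.subset

theorem IsFace.refl {P : Set E} (h : P.Nonempty) : IsFace P P := ⟨h, IsExposed.refl P⟩

theorem IsFace.of_subset {P F G : Set E} (hF : IsFace P F) (hG : IsFace P G) (h : G ⊆ F) :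
    IsFace F G := ⟨hG.1, hG.2.mono hF.subset h⟩

theorem isFace_setOf_maximal {P : Set E} {x : E} (l : StrongDual ℝ E) (hx : x ∈ P)
    (hl : ∀ y ∈ P, l y ≤ l x) : IsFace P {z ∈ P | ∀ y ∈ P, l y ≤ l z} :=
  ⟨⟨x, hx, hl⟩, fun _ => ⟨l, rfl⟩⟩

theorem le_of_mem_convexHull {s : Set E} (l : StrongDual ℝ E) {c : ℝ} (h : ∀ y ∈ s, l y ≤ c)
    {x : E} (hx : x ∈ convexHull ℝ s) : l x ≤ c :=
  convexHull_min (t := {x | l x ≤ c}) h (convex_halfSpace_le l.toLinearMap.isLinear c) hx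

/-- A point of a polytope at which a segment from `v` ends lies in a face avoiding `v`. -/
theorem IsPolytope.exists_isFace_notMem [FiniteDimensional ℝ E] {P : Set E} (hP : IsPolytope P)
    {x v : E} (hx : x ∈ P) (h : ∀ ε : ℝ, 0 < ε → x + ε • (x - v) ∉ P) :
    ∃ F, IsFace P F ∧ x ∈ F ∧ v ∉ F := by
  obtain ⟨s, hs, rfl⟩ := hP
  lift s to Finset E using hs
  rcases exists_nonneg_combination_or_separating s (fun y => y - x) (x - v) with
    ⟨w, hw, hwb⟩ | ⟨l, hl, hlb⟩
  · exfalso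
    set W := ∑ y ∈ s, w y with hW
    have hW0 : 0 ≤ W := Finset.sum_nonneg hw
    -- With this step length the new point is a convex combination: weight `1 / (W + 1)` on `x` and
    -- `w y / (W + 1)` on each `y`. The index `none` stands for `x`.
    refine h (1 / (W + 1)) (by positivity) ?_
    have hmem : ∀ y ∈ s, y ∈ convexHull ℝ (s : Set E) := fun y hy => subset_convexHull ℝ _ hy
    have hsum := (convex_convexHull ℝ (s : Set E)).sum_mem (t := Finset.insertNone s)
      (w := fun o => o.elim (1 / (W + 1)) fun y => w y / (W + 1))
      (z := fun o => o.elim x id) (by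
        intro o ho
        rcases o with _ | y
        · simp only [Option.elim]; positivity
        · exact div_nonneg (hw y (by simpa using ho)) (by positivity)) (by
        rw [Finset.sum_insertNone]
        simp only [Option.elim]
        rw [← Finset.sum_div, ← hW, ← add_div, add_comm]
        exact div_self (by positivity)) (by
        intro o ho
        rcases o with _ | y
        · exact hx
        · exact hmem y (by simpa using ho))
    rw [Finset.sum_insertNone] at hsum
    simp only [Option.elim, id] at hsum
    convert hsum using 1
    rw [← hwb]
    simp only [smul_sub, Finset.sum_sub_distrib, ← Finset.sum_smul, ← hW, Finset.smul_sum,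
      smul_smul]
    simp only [div_eq_inv_mul, mul_one]
    have : x = ((W + 1)⁻¹ + (W + 1)⁻¹ * W) • x := by
      rw [← mul_one_add, add_comm 1 W, inv_mul_cancel₀ (by positivity), one_smul]
    nth_rewrite 1 [this]
    rw [add_smul]
    abel
  · set m : StrongDual ℝ E := -(LinearMap.toContinuousLinearMap l) with hm
    have hmx : ∀ y ∈ convexHull ℝ (s : Set E), m y ≤ m x := by
      intro y hy
      refine le_of_mem_convexHull m (fun z hz => ?_) hy
      have := hl z hz
      simp only [map_sub] at this
      simp [hm]
      linarith
    refine ⟨_, isFace_setOf_maximal m hx hmx, ⟨hx, hmx⟩, fun hv => ?_⟩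
    have := hv.2 x hx
    simp only [map_sub] at hlb
    simp [hm] at this
    linarith

/-- Extreme points of an exposed face are extreme in the whole hull, hence belong to `s`;
Krein–Milman recovers the face from them. Finiteness of the set of faces follows. -/
theorem IsFace.eq_convexHull_inter {s : Set E} (hs : s.Finite) {F : Set E}
    (hF : IsFace (convexHull ℝ s) F) : F = convexHull ℝ (s ∩ F) := by
  have hc : IsCompact F := hF.2.isCompact (hs.isCompact_convexHull ℝ)
  have hconv : Convex ℝ F := hF.2.convex (convex_convexHull ℝ s)
  refine subset_antisymm ?_ (convexHull_min inter_subset_right hconv)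
  have hsub : F.extremePoints ℝ ⊆ s ∩ F := fun x hx =>
    ⟨extremePoints_convexHull_subset (hF.2.isExtreme.extremePoints_subset_extremePoints hx), hx.1⟩
  have hcl : IsClosed (convexHull ℝ (s ∩ F)) :=
    (hs.subset inter_subset_left).isClosed_convexHull ℝ
  calc F = closure (convexHull ℝ (F.extremePoints ℝ)) :=
        (closure_convexHull_extremePoints hc hconv).symm
    _ ⊆ convexHull ℝ (s ∩ F) := closure_minimal (convexHull_mono hsub) hcl

theorem IsPolytope.of_isFace {P F : Set E} (hP : IsPolytope P) (hF : IsFace P F) :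
    IsPolytope F := by
  obtain ⟨s, hs, rfl⟩ := hP
  exact ⟨s ∩ F, hs.subset inter_subset_left, hF.eq_convexHull_inter hs⟩

theorem IsPolytope.finite_setOf_isFace {P : Set E} (hP : IsPolytope P) :
    {F | IsFace P F}.Finite := by
  obtain ⟨s, hs, rfl⟩ := hP
  refine (hs.finite_subsets.image (convexHull ℝ)).subset fun F hF => ?_
  exact ⟨s ∩ F, inter_subset_left, (IsFace.eq_convexHull_inter hs hF).symm⟩

/-- A face of a face of a polytope is a face of the polytope. -/
theorem IsFace.trans {P F G : Set E} (hP : IsPolytope P) (hF : IsFace P F) (hG : IsFace F G) :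
    IsFace P G := by
  obtain ⟨s, hs, rfl⟩ := hP
  obtain ⟨x, hx⟩ := hG.1
  obtain ⟨l, hl⟩ := hF.2 hF.1
  obtain ⟨m, hm⟩ := hG.2 hG.1
  have hxF : x ∈ F := hG.subset hx
  have hxl : ∀ y ∈ convexHull ℝ s, l y ≤ l x := by rw [hl] at hxF; exact hxF.2
  have hxm : ∀ y ∈ F, m y ≤ m x := by rw [hm] at hx; exact hx.2
  have hlF : ∀ y ∈ F, l y = l x := fun y hy => by
    refine le_antisymm (hxl y (hF.subset hy)) ?_
    rw [hl] at hy
    exact hy.2 x (hF.subset hxF)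
  -- Only finitely many generators lie outside `F`, each strictly below the maximum of `l`, so a
  -- small multiple of `m` keeps them below. Then `l + ε • m` exposes `G` in the polytope.
  obtain ⟨ε, hε, hε0⟩ : ∃ ε : ℝ, (∀ y ∈ s, y ∉ F → l y + ε * m y < l x + ε * m x) ∧ 0 < ε := by
    have h1 : ∀ᶠ ε in nhdsWithin (0 : ℝ) (Ioi 0),
        ∀ y ∈ s, y ∉ F → l y + ε * m y < l x + ε * m x := by
      rw [Filter.eventually_all_finite hs]
      intro y hy
      by_cases hyF : y ∈ F
      · simp [hyF]
      have hlt : l y < l x := by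
        refine lt_of_le_of_ne (hxl y (subset_convexHull ℝ s hy)) fun he => hyF ?_
        rw [hl]
        exact ⟨subset_convexHull ℝ s hy, fun z hz => he ▸ hxl z hz⟩
      have hcont : ContinuousAt (fun ε : ℝ => l x + ε * m x - (l y + ε * m y)) 0 := by fun_prop
      have := hcont.eventually_const_lt (u := 0) (by simpa using hlt)
      filter_upwards [this.filter_mono nhdsWithin_le_nhds] with ε hε _
      linarith
    exact (h1.and self_mem_nhdsWithin).exists
  set k : StrongDual ℝ E := l + ε • m with hk
  have hkapp : ∀ y, k y = l y + ε * m y := fun y => by simp [hk]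
  have hkx : ∀ y ∈ convexHull ℝ s, k y ≤ k x := fun y hy => by
    refine le_of_mem_convexHull k (fun z hz => ?_) hy
    rw [hkapp, hkapp]
    by_cases hzF : z ∈ F
    · rw [hlF z hzF]
      have := mul_le_mul_of_nonneg_left (hxm z hzF) hε0.le
      linarith
    · exact (hε z hz hzF).le
  have hface := isFace_setOf_maximal k (hF.subset hxF) hkx
  convert hface using 1
  refine subset_antisymm (fun y hy => ?_) ?_
  · refine ⟨hF.subset (hG.subset hy), fun z hz => (hkx z hz).trans_eq ?_⟩
    rw [hkapp, hkapp, hlF y (hG.subset hy)]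
    rw [hm] at hy hx
    rw [le_antisymm (hx.2 y hy.1) (hy.2 x hx.1)]
  · rw [hface.eq_convexHull_inter hs]
    have hGc : Convex ℝ G := hG.2.convex (hF.2.convex (convex_convexHull ℝ s))
    refine convexHull_min ?_ hGc
    rintro y ⟨hys, hyP, hy⟩
    have hyx := hy x (hF.subset hxF)
    rw [hkapp, hkapp] at hyx
    have hyF : y ∈ F := by
      by_contra hyF
      exact absurd hyx (not_le.2 (hε y hys hyF))
    rw [hlF y hyF] at hyx
    have : m x ≤ m y := le_of_mul_le_mul_left (by linarith) hε0
    rw [hm]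
    exact ⟨hyF, fun z hz => (hxm z hz).trans this⟩

/-- The smallest face of `P` containing `A`. -/
def carrier (P A : Set E) : Set E := ⋂₀ {F | IsFace P F ∧ A ⊆ F}

theorem subset_carrier (P A : Set E) : A ⊆ carrier P A := subset_sInter fun _ hF => hF.2

theorem carrier_subset {P A F : Set E} (hF : IsFace P F) (hA : A ⊆ F) : carrier P A ⊆ F :=
  sInter_subset_of_mem ⟨hF, hA⟩

theorem IsPolytope.isFace_carrier {P A : Set E} (hP : IsPolytope P) (hA : A.Nonempty)
    (hAP : A ⊆ P) : IsFace P (carrier P A) := by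
  refine ⟨hA.mono (subset_carrier P A), ?_⟩
  have hfin : {F | IsFace P F ∧ A ⊆ F}.Finite := hP.finite_setOf_isFace.subset fun F hF => hF.1
  have := IsExposed.sInter (𝕜 := ℝ) (A := P) (F := hfin.toFinset)
    ⟨P, by simpa using ⟨IsFace.refl (hA.mono hAP), hAP⟩⟩ (by
      intro B hB
      exact (hfin.mem_toFinset.1 hB).1.2)
  simpa [carrier] using this

/-- The faces of `F` are the faces of `P` inside `F`, so carriers may be computed in either
polytope; this lets the induction on dimension pass to faces. -/
theorem carrier_eq_of_isFace {P F A : Set E} (hP : IsPolytope P) (hF : IsFace P F)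
    (hne : A.Nonempty) (hA : A ⊆ F) : carrier F A = carrier P A := by
  refine subset_antisymm ?_ ?_
  · have hc := hP.isFace_carrier hne (hA.trans hF.subset)
    exact carrier_subset (hF.of_subset hc (carrier_subset hF hA)) (subset_carrier P A)
  · exact subset_sInter fun G hG => carrier_subset (hF.trans hP hG.1) hG.2

end Geometry

-- Barycenters, covering by top simplices, and the cone structure at the apex.

section Simplices

variable {E : Type*} [NormedAddCommGroup E] [NormedSpace ℝ E]

/-- The barycenter of a finite set of points. -/
noncomputable def barycenter (t : Finset E) : E := ∑ y ∈ t, (t.card : ℝ)⁻¹ • y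

theorem sum_inv_card {ι : Type*} {t : Finset ι} (ht : t.Nonempty) : ∑ _y ∈ t, (t.card : ℝ)⁻¹ = 1 := by
  have : (t.card : ℝ) ≠ 0 := by simpa using ht.ne_empty
  simp [this]

theorem barycenter_mem_convexHull {t : Finset E} (ht : t.Nonempty) :
    barycenter t ∈ convexHull ℝ (t : Set E) :=
  Finset.mem_convexHull'.2 ⟨fun _ => (t.card : ℝ)⁻¹, fun _ _ => by positivity, sum_inv_card ht, rfl⟩

/-- Barycentric coordinates are unique, and all those of the barycenter are nonzero. -/
theorem subset_of_barycenter_mem {t r : Finset E} (ht : t.Nonempty)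
    (hi : AffineIndependent ℝ ((↑) : t → E))
    (h : barycenter t ∈ convexHull ℝ (t ∩ r : Set E)) : t ⊆ r := by
  classical
  rw [← Finset.coe_inter, Finset.mem_convexHull'] at h
  obtain ⟨w, -, hw1, hwx⟩ := h
  have key := hi.eq_zero_of_sum_eq_zero_subtype
    (w := fun y => (t.card : ℝ)⁻¹ - if y ∈ r then w y else 0)
    (by rw [Finset.sum_sub_distrib, sum_inv_card ht, ← Finset.sum_filter,
      Finset.filter_mem_eq_inter, hw1, sub_self])
    (by
      simp only [sub_smul, ite_smul, zero_smul, Finset.sum_sub_distrib]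
      rw [← Finset.sum_filter, Finset.filter_mem_eq_inter, hwx, barycenter, sub_self])
  intro y hy
  by_contra hyr
  have := key y hy
  simp [hyr, ht.ne_empty] at this

/-- A segment ending at a vertex of a simplex and crossing a facet at an inner point starts in
this facet. -/
theorem mem_of_extension_mem_convexHull {t r : Finset E} (hi : AffineIndependent ℝ ((↑) : r → E))
    (htr : t ⊆ r) {x v : E} (hv : v ∈ r) (hx : x ∈ convexHull ℝ (t : Set E)) {ε : ℝ} (hε : 0 < ε)
    (hy : x + ε • (x - v) ∈ convexHull ℝ (r : Set E)) : v ∈ t := by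
  classical
  by_contra hvt
  obtain ⟨w, -, hw1, hwx⟩ := Finset.mem_convexHull'.1 hx
  obtain ⟨u, hu0, hu1, hux⟩ := Finset.mem_convexHull'.1 hy
  -- Compare two expressions of `x + ε • (x - v) + ε • v = (1 + ε) • x`. If `v ∉ t`, the coordinate
  -- at `v` gives `u v = -ε < 0`.
  have key := hi.eq_zero_of_sum_eq_zero_subtype
    (w := fun p => u p + (if p = v then ε else 0) - (1 + ε) * if p ∈ t then w p else 0)
    (by
      rw [Finset.sum_sub_distrib, Finset.sum_add_distrib, hu1, ← Finset.mul_sum,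
        Finset.sum_ite_eq' r v, if_pos hv, ← Finset.sum_filter,
        Finset.filter_mem_eq_inter, Finset.inter_eq_right.2 htr, hw1]
      ring)
    (by
      simp only [sub_smul (_ : ℝ), add_smul (u _), ite_smul, zero_smul, Finset.sum_sub_distrib,
        Finset.sum_add_distrib, mul_ite, mul_zero, mul_smul]
      rw [hux, Finset.sum_ite_eq' r v, if_pos hv, ← Finset.sum_filter,
        Finset.filter_mem_eq_inter, Finset.inter_eq_right.2 htr, ← Finset.smul_sum,
        hwx]
      module)
  have h1 := key v hv
  have h2 := hu0 v hv
  simp [hvt] at h1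
  linarith

theorem dim_convexHull (s : Set E) : dim (convexHull ℝ s) = dim s := by
  unfold dim
  rw [← direction_affineSpan, affineSpan_convexHull, direction_affineSpan]

theorem dim_add_one_of_affineIndependent {t : Finset E} (ht : t.Nonempty)
    (hi : AffineIndependent ℝ ((↑) : t → E)) : dim (t : Set E) + 1 = t.card := by
  have h1 : Fintype.card t = (t.card - 1) + 1 := by
    rw [Fintype.card_coe]
    have := ht.card_pos
    omega
  have := hi.finrank_vectorSpan h1
  rw [Subtype.range_coe_subtype] at this
  have h3 := ht.card_pos
  unfold dim
  rw [show {x | x ∈ t} = (t : Set E) from rfl] at this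
  rw [this]
  omega

theorem mem_of_mem_extremePoints {P : Set E} {t : Finset E} {x : E}
    (hx : x ∈ P.extremePoints ℝ) (htP : convexHull ℝ (t : Set E) ⊆ P)
    (hxt : x ∈ convexHull ℝ (t : Set E)) : x ∈ t :=
  extremePoints_convexHull_subset (inter_extremePoints_subset_extremePoints_of_subset htP ⟨hxt, hx⟩)

/-- The full-dimensional simplices of a finite triangulation of a convex set cover it. -/
theorem exists_top_simplex_of_mem [FiniteDimensional ℝ E] (C : SimplicialComplex ℝ E) (hfin : C.faces.Finite)
    {P : Set E} (hP : Convex ℝ P)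
    (hcov : ⋃ s ∈ restrictFaces C P, convexHull ℝ (s : Set E) = P) {x : E} (hx : x ∈ P) :
    ∃ s ∈ restrictFaces C P, s.card = dim P + 1 ∧ x ∈ convexHull ℝ (s : Set E) := by
  by_contra! hcon
  have hTfin : (restrictFaces C P).Finite := hfin.subset fun s hs => hs.1
  set U : Set E := ⋃ s ∈ {s | s ∈ restrictFaces C P ∧ s.card = dim P + 1},
    convexHull ℝ (s : Set E) with hU
  have hUcl : IsClosed U :=
    (hTfin.subset fun s hs => hs.1).isClosed_biUnion fun s _ =>
      s.finite_toSet.isClosed_convexHull ℝ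
  have hxU : x ∉ U := by
    simp only [hU, mem_iUnion, not_exists]
    rintro s ⟨hs, hc⟩
    exact hcon s hs hc
  obtain ⟨r, hr, hball⟩ := Metric.isOpen_iff.1 hUcl.isOpen_compl x hxU
  -- A ball around `x` misses the closed union of the top simplices, so `P` near `x` is covered by
  -- the affine spans of the other simplices and lies in one of them.
  obtain ⟨s, hs, hsK⟩ := Convex.exists_subset_of_subset_biUnion
    (hP.inter (convex_ball x r)) ⟨x, hx, Metric.mem_ball_self hr⟩
    (hTfin.subset (fun s (hs : s ∈ {s | s ∈ restrictFaces C P ∧ s.card ≠ dim P + 1}) =>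
      hs.1)).toFinset (fun s => affineSpan ℝ (s : Set E)) (by
      rintro y ⟨hyP, hyb⟩
      rw [← hcov] at hyP
      simp only [mem_iUnion] at hyP ⊢
      obtain ⟨s, hs, hys⟩ := hyP
      refine ⟨s, ?_, convexHull_subset_affineSpan _ hys⟩
      rw [Set.Finite.mem_toFinset]
      refine ⟨hs, fun hc => hball hyb ?_⟩
      exact mem_biUnion (show s ∈ {s | s ∈ restrictFaces C P ∧ s.card = dim P + 1} from ⟨hs, hc⟩)
        hys)
  rw [Set.Finite.mem_toFinset] at hs
  obtain ⟨hs, hc⟩ := hs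
  -- The part of `P` near `x` spans all of `P`: move a point of `P` towards `x` into the ball, then
  -- extrapolate back.
  have hPs : P ⊆ affineSpan ℝ (s : Set E) := by
    intro y hy
    have hxs : x ∈ affineSpan ℝ (s : Set E) := hsK ⟨hx, Metric.mem_ball_self hr⟩
    obtain ⟨t, ⟨htb, ht1⟩, ht0⟩ : ∃ t : ℝ, (AffineMap.lineMap x y t ∈ Metric.ball x r ∧ t < 1) ∧
        0 < t := by
      have hc : Continuous fun t : ℝ => (AffineMap.lineMap x y t : E) :=
        AffineMap.lineMap_continuous
      have h1 : ∀ᶠ t in nhds (0 : ℝ), (AffineMap.lineMap x y t : E) ∈ Metric.ball x r := by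
        refine hc.continuousAt.eventually_mem ?_
        simpa using Metric.ball_mem_nhds x hr
      have h2 := (h1.and (eventually_lt_nhds zero_lt_one)).filter_mono
        (nhdsWithin_le_nhds (s := Ioi 0))
      exact (h2.and self_mem_nhdsWithin).exists
    have hz := hsK ⟨hP.lineMap_mem hx hy ⟨ht0.le, ht1.le⟩, htb⟩
    have := AffineMap.lineMap_mem t⁻¹ hxs hz
    convert this using 1
    simp [AffineMap.lineMap_apply, smul_smul, inv_mul_cancel₀ ht0.ne']
  have h1 : dim P ≤ dim (s : Set E) := by
    refine Submodule.finrank_mono ?_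
    rw [← direction_affineSpan, ← direction_affineSpan]
    exact AffineSubspace.direction_le (affineSpan_le.2 hPs)
  have h2 : dim (s : Set E) ≤ dim P :=
    Submodule.finrank_mono (vectorSpan_mono ℝ ((subset_convexHull ℝ _).trans hs.2))
  have h3 := dim_add_one_of_affineIndependent (C.nonempty_of_mem_faces hs.1) (C.indep hs.1)
  omega

theorem subset_of_barycenter_mem_convexHull {C : SimplicialComplex ℝ E} {t s : Finset E}
    (ht : t ∈ C.faces) (hs : s ∈ C.faces)
    (h : barycenter t ∈ convexHull ℝ (s : Set E)) : t ⊆ s :=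
  subset_of_barycenter_mem (C.nonempty_of_mem_faces ht) (C.indep ht)
    (C.inter_subset_convexHull ht hs
      ⟨barycenter_mem_convexHull (C.nonempty_of_mem_faces ht), h⟩)

/-- A face containing the barycenter of a simplex contains the simplex. -/
theorem IsFace.convexHull_subset_of_barycenter_mem {P F : Set E} (hP : Convex ℝ P)
    (hF : IsFace P F) {t : Finset E} (ht : t.Nonempty) (htP : (t : Set E) ⊆ P)
    (h : barycenter t ∈ F) : convexHull ℝ (t : Set E) ⊆ F := by
  refine convexHull_min (fun y hy => ?_) (hF.2.convex hP)
  obtain ⟨l, hl⟩ := hF.2 hF.1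
  rw [hl] at h ⊢
  have hle : ∀ z ∈ t, (t.card : ℝ)⁻¹ * l z ≤ (t.card : ℝ)⁻¹ * l (barycenter t) := fun z hz =>
    mul_le_mul_of_nonneg_left (h.2 z (htP hz)) (by positivity)
  -- The value of `l` at the barycenter is the average over the vertices; it is also maximal, so
  -- every vertex attains it.
  have hsum : ∑ z ∈ t, (t.card : ℝ)⁻¹ * l z = ∑ z ∈ t, (t.card : ℝ)⁻¹ * l (barycenter t) := by
    rw [← Finset.sum_mul, sum_inv_card ht, one_mul]
    conv_rhs => rw [barycenter]
    simp
  have := (Finset.sum_eq_sum_iff_of_le hle).1 hsum y hy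
  have hpos : (0 : ℝ) < (t.card : ℝ)⁻¹ := by
    have := ht.card_pos
    positivity
  have hy' : l y = l (barycenter t) := mul_left_cancel₀ hpos.ne' this
  exact ⟨htP hy, fun z hz => hy' ▸ h.2 z hz⟩

/-- A triangulation of `P` by simplices of `C` whose full-dimensional simplices of each face
share the apex of the face. -/
structure IsApexTriangulation (P : Set E) (C : SimplicialComplex ℝ E) (v : Set E → E) :
    Prop where
  finite : C.faces.Finite
  triangulates : ∀ F, IsFace P F → ⋃ s ∈ restrictFaces C F, convexHull ℝ (s : Set E) = F
  apex_mem_vertices : ∀ F, IsFace P F → v F ∈ F.extremePoints ℝ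
  apex_mem_simplex : ∀ F, IsFace P F → ∀ s ∈ restrictFaces C F,
    s.card = dim F + 1 → v F ∈ convexHull ℝ (s : Set E)

theorem IsPointedTriangulation.isApexTriangulation {P : Set E} {C : SimplicialComplex ℝ E}
    {v : Set E → E} (h : IsPointedTriangulation P C v) : IsApexTriangulation P C v :=
  ⟨h.finite, h.triangulates, h.apex_mem_vertices, h.apex_mem_simplex⟩

/-- The smallest face of `P` containing the simplex with vertex set `t`. -/
abbrev simplexCarrier (P : Set E) (t : Finset E) : Set E := carrier P (convexHull ℝ (t : Set E))

namespace IsApexTriangulation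

variable {P : Set E} {C : SimplicialComplex ℝ E} {v : Set E → E}

theorem of_isFace (h : IsApexTriangulation P C v) (hP : IsPolytope P) {F : Set E}
    (hF : IsFace P F) : IsApexTriangulation F C v :=
  ⟨h.finite, fun G hG => h.triangulates G (hF.trans hP hG),
    fun G hG => h.apex_mem_vertices G (hF.trans hP hG),
    fun G hG => h.apex_mem_simplex G (hF.trans hP hG)⟩

theorem apex_mem (h : IsApexTriangulation P C v) (hne : P.Nonempty) : v P ∈ P :=
  (h.apex_mem_vertices P (IsFace.refl hne)).1

/-- Every point of `P` lies in a simplex that has the apex of `P` as a vertex. -/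
theorem exists_simplex_of_mem [FiniteDimensional ℝ E] (h : IsApexTriangulation P C v) (hP : IsPolytope P)
    {x : E} (hx : x ∈ P) :
    ∃ s ∈ restrictFaces C P, v P ∈ s ∧ x ∈ convexHull ℝ (s : Set E) := by
  have hPP := IsFace.refl ⟨x, hx⟩
  obtain ⟨s, hs, hc, hxs⟩ := exists_top_simplex_of_mem C h.finite hP.convex (h.triangulates P hPP) hx
  exact ⟨s, hs, mem_of_mem_extremePoints (h.apex_mem_vertices P hPP) hs.2
    (h.apex_mem_simplex P hPP s hs hc), hxs⟩

theorem mem_restrictFaces_of_subset {s t : Finset E} (hs : s ∈ restrictFaces C P) (hts : t ⊆ s)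
    (ht : t.Nonempty) : t ∈ restrictFaces C P :=
  ⟨C.down_closed hs.1 hts ht, (convexHull_mono (by exact_mod_cast hts)).trans hs.2⟩

theorem singleton_apex_mem [FiniteDimensional ℝ E] (h : IsApexTriangulation P C v) (hP : IsPolytope P)
    (hne : P.Nonempty) : {v P} ∈ restrictFaces C P := by
  obtain ⟨s, hs, hv, -⟩ := h.exists_simplex_of_mem hP hne.some_mem
  exact mem_restrictFaces_of_subset hs (by simpa using hv) (Finset.singleton_nonempty _)

/-- The barycenter of `t` lies in a simplex with the apex as a vertex; that simplex has `t` as a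
face, so it also has `insert (v P) t` as a face. -/
theorem insert_apex_mem [FiniteDimensional ℝ E] [DecidableEq E] (h : IsApexTriangulation P C v) (hP : IsPolytope P)
    {t : Finset E} (ht : t ∈ restrictFaces C P) : insert (v P) t ∈ restrictFaces C P := by
  have hb := barycenter_mem_convexHull (C.nonempty_of_mem_faces ht.1)
  obtain ⟨s, hs, hv, hx⟩ := h.exists_simplex_of_mem hP (ht.2 hb)
  refine mem_restrictFaces_of_subset hs (Finset.insert_subset hv ?_) (Finset.insert_nonempty _ _)
  exact subset_of_barycenter_mem_convexHull ht.1 hs.1 hx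

/-- A simplex of the triangulation without the apex of `P` lies in a face of `P` that does not
contain this apex. -/
theorem apex_mem_carrier_iff [FiniteDimensional ℝ E] (h : IsApexTriangulation P C v) (hP : IsPolytope P)
    {t : Finset E} (ht : t ∈ restrictFaces C P) :
    v P ∈ simplexCarrier P t ↔ v P ∈ t := by
  have htne := C.nonempty_of_mem_faces ht.1
  have hb := barycenter_mem_convexHull htne
  refine ⟨fun hc => ?_, fun hv => subset_carrier _ _ (subset_convexHull ℝ _ hv)⟩
  by_contra hvt
  -- If the segment from the apex could be prolonged past the barycenter, the new endpoint would lie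
  -- in a simplex containing the apex. By convexity that simplex contains the barycenter, hence `t`,
  -- which forces the apex into `t`.
  obtain ⟨F, hF, hxF, hvF⟩ := hP.exists_isFace_notMem (v := v P) (ht.2 hb) fun ε hε hy => by
    obtain ⟨s, hs, hv, hys⟩ := h.exists_simplex_of_mem hP hy
    have hxs : barycenter t ∈ convexHull ℝ (s : Set E) := by
      have := (convex_convexHull ℝ (s : Set E)) hys (subset_convexHull ℝ _ hv)
        (a := (1 + ε)⁻¹) (b := (1 + ε)⁻¹ * ε) (by positivity) (by positivity) (by field_simp)
      convert this using 1
      rw [mul_smul, ← smul_add]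
      have h2 : barycenter t + ε • (barycenter t - v P) + ε • v P = (1 + ε) • barycenter t := by
        module
      rw [h2, inv_smul_smul₀ (by positivity)]
    exact hvt (mem_of_extension_mem_convexHull (C.indep hs.1)
      (subset_of_barycenter_mem_convexHull ht.1 hs.1 hxs) hv hb hε hys)
  exact hvF (carrier_subset hF (hF.convexHull_subset_of_barycenter_mem hP.convex htne
    ((subset_convexHull ℝ _).trans ht.2) hxF) hc)

end IsApexTriangulation

end Simplices

-- Binomial sums over simplices.

noncomputable section Counting

open scoped Classical

variable {E : Type*} [NormedAddCommGroup E] [NormedSpace ℝ E]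

theorem polytopeNumber_of_dim_eq_zero [FiniteDimensional ℝ E] (v : Set E → E) {P : Set E} (h : dim P = 0) (m : ℕ) :
    polytopeNumber v P (m + 1) = 1 := by
  rcases m with _ | m
  · rw [polytopeNumber]
  · rw [polytopeNumber, if_pos h]

/-- In dimension zero there are no proper faces, so the recursion needs no case distinction there.
-/
theorem polytopeNumber_add_two [FiniteDimensional ℝ E] (v : Set E → E) {P : Set E} (hP : IsPolytope P) (m : ℕ) :
    polytopeNumber v P (m + 2) = polytopeNumber v P (m + 1) +
      ∑ F ∈ hP.finite_setOf_isFace.toFinset with F ≠ P ∧ v P ∉ F, interiorNumber v F (m + 2) := by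
  by_cases h : dim P = 0
  · rw [polytopeNumber_of_dim_eq_zero v h, polytopeNumber_of_dim_eq_zero v h, Finset.sum_eq_zero,
      add_zero]
    intro F hF
    simp only [Finset.mem_filter, Finite.mem_toFinset, mem_ofPred_eq] at hF
    have := dim_lt_of_isFace hF.1 hF.2.1
    omega
  · rw [polytopeNumber, if_neg h]
    congr 1
    have hfin : Finite {F : Set E // (IsFace P F ∧ F ≠ P) ∧ v P ∉ F} :=
      (hP.finite_setOf_isFace.subset fun F hF => hF.1.1 :
        {F : Set E | (IsFace P F ∧ F ≠ P) ∧ v P ∉ F}.Finite).to_subtype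
    have := Fintype.ofFinite {F : Set E // (IsFace P F ∧ F ≠ P) ∧ v P ∉ F}
    rw [finsum_eq_sum_of_fintype]
    refine (Finset.sum_subtype _ (fun F => ?_) fun F => interiorNumber v F (m + 2)).symm
    simp [and_assoc]

theorem interiorNumber_add_two [FiniteDimensional ℝ E] (v : Set E → E) {P : Set E} (hP : IsPolytope P) (m : ℕ) :
    interiorNumber v P (m + 2) = polytopeNumber v P (m + 2) -
      ∑ F ∈ hP.finite_setOf_isFace.toFinset with F ≠ P, interiorNumber v F (m + 2) := by
  rw [interiorNumber]
  by_cases h : dim P = 0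
  · rw [if_pos h, if_neg (by omega), polytopeNumber_of_dim_eq_zero v h, Finset.sum_eq_zero,
      sub_zero]
    intro F hF
    simp only [Finset.mem_filter, Finite.mem_toFinset, mem_ofPred_eq] at hF
    have := dim_lt_of_isFace hF.1 hF.2
    omega
  · rw [if_neg h, if_neg (by omega)]
    congr 1
    have hfin : Finite {F : Set E // IsFace P F ∧ F ≠ P} :=
      (hP.finite_setOf_isFace.subset fun F hF => hF.1 :
        {F : Set E | IsFace P F ∧ F ≠ P}.Finite).to_subtype
    have := Fintype.ofFinite {F : Set E // IsFace P F ∧ F ≠ P}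
    rw [finsum_eq_sum_of_fintype]
    refine (Finset.sum_subtype _ (fun F => ?_) fun F => interiorNumber v F (m + 2)).symm
    simp

variable {P : Set E} {C : SimplicialComplex ℝ E} {v : Set E → E}

namespace IsApexTriangulation

/-- Removing the apex matches the simplices with the apex with those without it. -/
theorem sum_choose_succ [FiniteDimensional ℝ E] (h : IsApexTriangulation P C v) (hP : IsPolytope P)
    {T : Finset (Finset E)} (hT : ∀ t, t ∈ T ↔ t ∈ restrictFaces C P) (m : ℕ) :
    ∑ t ∈ T with v P ∈ t, ((m + 1).choose (t.card - 1) : ℤ) =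
      ∑ t ∈ T with v P ∈ t, (m.choose (t.card - 1) : ℤ) +
        ∑ t ∈ T with v P ∉ t, (m.choose (t.card - 1) : ℤ) := by
  have hlink : ∑ t ∈ T with v P ∉ t, (m.choose (t.card - 1) : ℤ) =
      ∑ t ∈ T with v P ∈ t ∧ t.card ≠ 1, (m.choose (t.card - 2) : ℤ) := by
    refine Finset.sum_bij' (fun t _ => insert (v P) t) (fun t _ => t.erase (v P)) ?_ ?_ ?_ ?_ ?_
    · intro t ht
      simp only [Finset.mem_filter, hT] at ht ⊢
      refine ⟨h.insert_apex_mem hP ht.1, Finset.mem_insert_self _ _, ?_⟩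
      have := (C.nonempty_of_mem_faces ht.1.1).card_pos
      rw [Finset.card_insert_of_notMem ht.2]
      omega
    · intro t ht
      simp only [Finset.mem_filter, hT] at ht ⊢
      refine ⟨mem_restrictFaces_of_subset ht.1 (Finset.erase_subset _ _) ?_,
        Finset.notMem_erase _ _⟩
      have := (C.nonempty_of_mem_faces ht.1.1).card_pos
      rw [← Finset.card_pos, Finset.card_erase_of_mem ht.2.1]
      omega
    · intro t ht
      exact Finset.erase_insert (Finset.mem_filter.1 ht).2
    · intro t ht
      exact Finset.insert_erase (Finset.mem_filter.1 ht).2.1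
    · intro t ht
      rw [Finset.card_insert_of_notMem (Finset.mem_filter.1 ht).2]
      rfl
  rw [hlink, ← Finset.filter_filter, Finset.sum_filter (p := fun t : Finset E => t.card ≠ 1),
    ← Finset.sum_add_distrib]
  refine Finset.sum_congr rfl fun t ht => ?_
  have hpos := (C.nonempty_of_mem_faces ((hT t).1 (Finset.mem_filter.1 ht).1).1).card_pos
  obtain ⟨k, hk⟩ : ∃ k, t.card = k + 1 := ⟨t.card - 1, by omega⟩
  rcases k with _ | k
  -- For the vertex `{v P}` both binomials equal 1, and there is no opposite simplex to contribute.
  · simp [hk]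
  · simp only [hk, Nat.add_sub_cancel, Nat.choose_succ_succ]
    have h1 : k + 1 + 1 ≠ 1 := by omega
    rw [if_pos h1]
    push_cast
    exact add_comm _ _

theorem isFace_carrier_convexHull (hP : IsPolytope P) {t : Finset E}
    (ht : t ∈ restrictFaces C P) : IsFace P (simplexCarrier P t) :=
  hP.isFace_carrier (convexHull_nonempty_iff.2 (Finset.coe_nonempty.2 (C.nonempty_of_mem_faces ht.1)))
    ht.2

theorem sum_carrier_eq (hP : IsPolytope P) {T : Finset (Finset E)}
    (hT : ∀ t, t ∈ T ↔ t ∈ restrictFaces C P) {F : Set E} (hF : IsFace P F)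
    {T' : Finset (Finset E)} (hT' : ∀ t, t ∈ T' ↔ t ∈ restrictFaces C F) :
    {t ∈ T' | simplexCarrier F t = F} =
      {t ∈ T | simplexCarrier P t = F} := by
  ext t
  simp only [Finset.mem_filter, hT, hT']
  have key : t ∈ restrictFaces C F →
      simplexCarrier F t = simplexCarrier P t := fun ht =>
    carrier_eq_of_isFace hP hF
      (convexHull_nonempty_iff.2 (Finset.coe_nonempty.2 (C.nonempty_of_mem_faces ht.1))) ht.2
  constructor
  · rintro ⟨ht, hc⟩
    exact ⟨⟨ht.1, ht.2.trans hF.subset⟩, key ht ▸ hc⟩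
  · rintro ⟨ht, hc⟩
    have ht' : t ∈ restrictFaces C F := ⟨ht.1, hc ▸ subset_carrier _ _⟩
    exact ⟨ht', (key ht').trans hc⟩

/-- The two formulas are proved together by induction on dimension, since each recursion calls
interior numbers of proper faces. The shifts differ because the interior numbers at `m + 2` make up
the increment from `m + 1` to `m + 2`, which Pascal's rule expresses through `m.choose`. -/
theorem numbers_eq_sum [FiniteDimensional ℝ E] (d : ℕ) : ∀ {P : Set E}, dim P = d → IsPolytope P → P.Nonempty →
    IsApexTriangulation P C v → ∀ {T : Finset (Finset E)},
    (∀ t, t ∈ T ↔ t ∈ restrictFaces C P) → ∀ m,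
    polytopeNumber v P (m + 1) = ∑ t ∈ T with v P ∈ t, (m.choose (t.card - 1) : ℤ) ∧
    interiorNumber v P (m + 2) = ∑ t ∈ T with simplexCarrier P t = P,
      (m.choose (t.card - 1) : ℤ) := by
  induction d using Nat.strong_induction_on with
  | _ d ih =>
  intro P hd hP hne h T hT
  have hproper : ∀ F, IsFace P F → F ≠ P → ∀ m, interiorNumber v F (m + 2) =
      ∑ t ∈ T with simplexCarrier P t = F, (m.choose (t.card - 1) : ℤ) := by
    intro F hF hFP m
    have hfin : (restrictFaces C F).Finite := h.finite.subset fun t ht => ht.1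
    have := (ih (dim F) (hd ▸ dim_lt_of_isFace hF hFP) rfl (hP.of_isFace hF) hF.1
      (h.of_isFace hP hF) (T := hfin.toFinset) (fun t => hfin.mem_toFinset) m).2
    rw [this, sum_carrier_eq hP hT hF fun t => hfin.mem_toFinset]
  have hfaces : ∀ F ∈ hP.finite_setOf_isFace.toFinset, IsFace P F := fun F hF =>
    hP.finite_setOf_isFace.mem_toFinset.1 hF
  have hmaps : ∀ t ∈ T, simplexCarrier P t ∈
      hP.finite_setOf_isFace.toFinset := fun t ht =>
    (Set.Finite.mem_toFinset _).2 (isFace_carrier_convexHull hP ((hT t).1 ht))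
  have hfiber : ∀ (p : Set E → Prop) [DecidablePred p] (m : ℕ),
      ∑ F ∈ hP.finite_setOf_isFace.toFinset with p F,
        ∑ t ∈ T with simplexCarrier P t = F, (m.choose (t.card - 1) : ℤ) =
      ∑ t ∈ T with p (simplexCarrier P t), (m.choose (t.card - 1) : ℤ) := by
    intro p _ m
    rw [← Finset.sum_fiberwise_of_maps_to (s := T.filter _)
      (t := hP.finite_setOf_isFace.toFinset.filter p)
      (g := fun t => simplexCarrier P t)
      (fun t ht => Finset.mem_filter.2
        ⟨hmaps t (Finset.mem_filter.1 ht).1, (Finset.mem_filter.1 ht).2⟩)]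
    refine Finset.sum_congr rfl fun F hF => Finset.sum_congr ?_ fun _ _ => rfl
    ext t
    simp only [Finset.mem_filter]
    constructor
    · rintro ⟨ht, rfl⟩
      exact ⟨⟨ht, (Finset.mem_filter.1 hF).2⟩, rfl⟩
    · rintro ⟨⟨ht, -⟩, hc⟩
      exact ⟨ht, hc⟩
  have hpoly : ∀ m, polytopeNumber v P (m + 1) =
      ∑ t ∈ T with v P ∈ t, (m.choose (t.card - 1) : ℤ) := by
    intro m
    induction m with
    | zero =>
      -- For `m = 0` only simplices with one vertex have nonzero weight.
      rw [polytopeNumber, Finset.sum_eq_single {v P}]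
      · simp
      · intro t ht hne'
        have hcard : t.card ≠ 1 := fun hc => by
          obtain ⟨a, rfl⟩ := Finset.card_eq_one.1 hc
          exact hne' (by rw [Finset.mem_singleton.1 (Finset.mem_filter.1 ht).2])
        have hpos := Finset.card_pos.2 ⟨v P, (Finset.mem_filter.1 ht).2⟩
        rw [Nat.choose_eq_zero_of_lt (by omega), Nat.cast_zero]
      · intro hn
        exact absurd (Finset.mem_filter (p := fun t => v P ∈ t) |>.2
          ⟨(hT _).2 (h.singleton_apex_mem hP hne), Finset.mem_singleton_self _⟩) hn
    | succ m ihm =>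
      rw [polytopeNumber_add_two v hP, ihm, h.sum_choose_succ hP hT]
      congr 1
      rw [Finset.sum_congr rfl (fun F hF => hproper F (hfaces F (Finset.mem_filter.1 hF).1)
        (Finset.mem_filter.1 hF).2.1 m), hfiber (fun F => F ≠ P ∧ v P ∉ F)]
      -- The condition that the carrier is not `P` is automatic, because `P` contains its apex.
      refine Finset.sum_congr (Finset.filter_congr fun t ht => ?_) fun _ _ => rfl
      rw [h.apex_mem_carrier_iff hP ((hT t).1 ht)]
      refine ⟨fun hh => hh.2, fun hh => ⟨fun hc => hh ?_, hh⟩⟩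
      rw [← h.apex_mem_carrier_iff hP ((hT t).1 ht), hc]
      exact h.apex_mem hne
  refine fun m => ⟨hpoly m, ?_⟩
  -- After Pascal's rule `polytopeNumber v P (m + 2)` is a sum over all simplices; subtracting the
  -- proper faces leaves those with carrier `P`.
  rw [interiorNumber_add_two v hP, hpoly, h.sum_choose_succ hP hT, Finset.sum_congr rfl
    (fun F hF => hproper F (hfaces F (Finset.mem_filter.1 hF).1) (Finset.mem_filter.1 hF).2 m),
    hfiber (fun F => F ≠ P), Finset.sum_filter_add_sum_filter_not, sub_eq_iff_eq_add,
    Finset.sum_filter_add_sum_filter_not]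

theorem polytopeNumber_succ [FiniteDimensional ℝ E] (h : IsApexTriangulation P C v) (hP : IsPolytope P)
    (hne : P.Nonempty) {T : Finset (Finset E)} (hT : ∀ t, t ∈ T ↔ t ∈ restrictFaces C P) (m : ℕ) :
    polytopeNumber v P (m + 1) = ∑ t ∈ T with v P ∈ t, (m.choose (t.card - 1) : ℤ) :=
  (numbers_eq_sum _ rfl hP hne h hT m).1

end IsApexTriangulation

/-- The complex of all the faces of a simplex. -/
def simplexComplex (s : Finset E) (hs : AffineIndependent ℝ ((↑) : s → E)) :
    SimplicialComplex ℝ E :=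
  SimplicialComplex.ofErase (𝕜 := ℝ) {t | t ⊆ s} (fun _ ht => hs.mono ht)
    (fun _ _ hab hb => hab.trans hb)
    (fun _ ha _ hb => (hs.convexHull_inter ha hb).ge)

theorem mem_simplexComplex {s t : Finset E} {hs : AffineIndependent ℝ ((↑) : s → E)} :
    t ∈ (simplexComplex s hs).faces ↔ t ⊆ s ∧ t.Nonempty := by
  rw [Finset.nonempty_iff_ne_empty]
  exact Iff.rfl

/-- Every face of a simplex is the hull of the vertices in it and is its own only full-dimensional
simplex, so any choice of vertices as apexes is admissible. -/
theorem isApexTriangulation_simplexComplex (s : Finset E)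
    (hs : AffineIndependent ℝ ((↑) : s → E))
    (hv : ∀ F, IsFace (convexHull ℝ (s : Set E)) F → v F ∈ F.extremePoints ℝ) :
    IsApexTriangulation (convexHull ℝ (s : Set E)) (simplexComplex s hs) v := by
  have hface : ∀ F, IsFace (convexHull ℝ (s : Set E)) F →
      ({y ∈ s | y ∈ F} ∈ restrictFaces (simplexComplex s hs) F) ∧
      F = convexHull ℝ (({y ∈ s | y ∈ F} : Finset E) : Set E) := by
    intro F hF
    have hF' : F = convexHull ℝ (({y ∈ s | y ∈ F} : Finset E) : Set E) := by
      conv_lhs => rw [hF.eq_convexHull_inter s.finite_toSet]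
      congr 1
      ext y
      simp
    refine ⟨⟨mem_simplexComplex.2 ⟨Finset.filter_subset _ _, ?_⟩, hF'.ge⟩, hF'⟩
    have := hF.1
    rw [hF', convexHull_nonempty_iff] at this
    exact_mod_cast this
  refine ⟨?_, fun F hF => ?_, hv, fun F hF t ht hc => ?_⟩
  · exact s.powerset.finite_toSet.subset fun t ht => by simpa using (mem_simplexComplex.1 ht).1
  · refine subset_antisymm (iUnion₂_subset fun t ht => ht.2) ?_
    obtain ⟨h1, h2⟩ := hface F hF
    nth_rewrite 1 [h2]
    exact subset_biUnion_of_mem (u := fun t : Finset E => convexHull ℝ (t : Set E)) h1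
  · obtain ⟨h1, h2⟩ := hface F hF
    have hsub : t ⊆ {y ∈ s | y ∈ F} := fun y hy =>
      Finset.mem_filter.2 ⟨(mem_simplexComplex.1 ht.1).1 hy, ht.2 (subset_convexHull ℝ _ hy)⟩
    have hdim := dim_add_one_of_affineIndependent (mem_simplexComplex.1 h1.1).2
      ((simplexComplex s hs).indep h1.1)
    rw [← dim_convexHull, ← h2] at hdim
    rw [Finset.eq_of_subset_of_card_le hsub (by omega), ← h2]
    exact (hv F hF).1

theorem polytopeNumber_simplex [FiniteDimensional ℝ E] {s : Finset E} (hs : AffineIndependent ℝ ((↑) : s → E))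
    {k : ℕ} (hk : s.card = k + 1)
    (hv : ∀ F, IsFace (convexHull ℝ (s : Set E)) F → v F ∈ F.extremePoints ℝ) (m : ℕ) :
    polytopeNumber v (convexHull ℝ (s : Set E)) (m + 1) = ((m + k).choose k : ℤ) := by
  have hne : (convexHull ℝ (s : Set E)).Nonempty :=
    convexHull_nonempty_iff.2 (by exact_mod_cast Finset.card_pos.1 (by omega))
  have h := isApexTriangulation_simplexComplex s hs hv
  have hvs : v (convexHull ℝ (s : Set E)) ∈ s :=
    extremePoints_convexHull_subset (hv _ (IsFace.refl hne))
  set a := v (convexHull ℝ (s : Set E)) with ha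
  rw [h.polytopeNumber_succ ⟨s, s.finite_toSet, rfl⟩ hne
    (T := s.powerset.erase ∅) (fun t => ?_), ← ha]
  · have hset : {t ∈ s.powerset.erase ∅ | a ∈ t} = (s.erase a).powerset.image (insert a) := by
      ext t
      simp only [Finset.mem_filter, Finset.mem_erase, Finset.mem_powerset, Finset.mem_image]
      constructor
      · rintro ⟨⟨-, hts⟩, hat⟩
        exact ⟨t.erase a, Finset.erase_subset_erase a hts, Finset.insert_erase hat⟩
      · rintro ⟨u, hu, rfl⟩
        exact ⟨⟨Finset.insert_ne_empty _ _,
          Finset.insert_subset hvs (hu.trans (Finset.erase_subset _ _))⟩,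
          Finset.mem_insert_self _ _⟩
    have hau : ∀ u ∈ (s.erase a).powerset, a ∉ u := fun u hu hau =>
      Finset.notMem_erase a s (Finset.mem_powerset.1 hu hau)
    rw [hset, Finset.sum_image fun u hu u' hu' he => by
      rw [← Finset.erase_insert (hau u hu), ← Finset.erase_insert (hau u' hu'), he]]
    -- Grouping the subsets `u` by size gives $\sum_j\binom kj\binom mj$, which is $\binom{m+k}k$ by
    -- Vandermonde.
    rw [Finset.sum_congr rfl fun u hu => by
      rw [Finset.card_insert_of_notMem (hau u hu), Nat.add_sub_cancel],
      Finset.sum_powerset_apply_card fun j => (m.choose j : ℤ), Finset.card_erase_of_mem hvs, hk,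
      Nat.add_sub_cancel, Nat.add_choose_eq, Finset.Nat.sum_antidiagonal_eq_sum_range_succ_mk]
    push_cast
    refine Finset.sum_congr rfl fun j hj => ?_
    rw [Nat.choose_symm (Nat.lt_succ_iff.1 (Finset.mem_range.1 hj)), nsmul_eq_mul, mul_comm]
  · simp only [Finset.mem_erase, Finset.mem_powerset, restrictFaces, mem_ofPred_eq,
      mem_simplexComplex, Finset.nonempty_iff_ne_empty]
    exact ⟨fun hh => ⟨hh.symm, convexHull_mono (by exact_mod_cast hh.2)⟩, fun hh => hh.1.symm⟩

end Counting

-- Evaluation of the simplex numbers.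

noncomputable section StandardSimplex

/-- The vertices of the standard simplex. -/
def standardVertices (k : ℕ) : Finset (EuclideanSpace ℝ (Fin (k + 1))) :=
  Finset.univ.map ⟨fun i => EuclideanSpace.single i (1 : ℝ), fun i j hij => by
    by_contra hne
    simpa [hne] using congrArg (fun x : EuclideanSpace ℝ (Fin (k + 1)) => x i) hij⟩

theorem coe_standardVertices (k : ℕ) : (standardVertices k : Set _) =
    Set.range fun i : Fin (k + 1) => EuclideanSpace.single i (1 : ℝ) := by
  rw [standardVertices, Finset.coe_map, Finset.coe_univ, Set.image_univ]
  rfl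

theorem affineIndependent_standardVertices (k : ℕ) :
    AffineIndependent ℝ ((↑) : standardVertices k → EuclideanSpace ℝ (Fin (k + 1))) := by
  have h := (EuclideanSpace.basisFun (Fin (k + 1)) ℝ).toBasis.linearIndependent.affineIndependent
  refine h.range.mono (s := (standardVertices k : Set _)) ?_
  rw [coe_standardVertices]
  rintro _ ⟨i, rfl⟩
  exact ⟨i, by simp⟩

/-- The linear function takes distinct values at the unit vectors, so its minimizers on a face form
a face with a single vertex. -/
theorem standardSimplexApex_mem_extremePoints (k : ℕ)
    {F : Set (EuclideanSpace ℝ (Fin (k + 1)))} (hF : IsFace (standardSimplex k) F) :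
    standardSimplexApex k F ∈ F.extremePoints ℝ := by
  have hfin : (Set.range fun i : Fin (k + 1) => EuclideanSpace.single i (1 : ℝ)).Finite :=
    Set.finite_range _
  have hP : IsPolytope (standardSimplex k) := ⟨_, hfin, rfl⟩
  set l : StrongDual ℝ (EuclideanSpace ℝ (Fin (k + 1))) :=
    -∑ i : Fin (k + 1), (((i : ℕ) : ℝ) + 1) • EuclideanSpace.proj i with hl
  have hlapp : ∀ x, l x = -∑ i : Fin (k + 1), (((i : ℕ) : ℝ) + 1) * x i := fun x => by
    simp [hl]
  have hex : ∃ x, x ∈ F ∧ ∀ y ∈ F, ∑ i : Fin (k + 1), (((i : ℕ) : ℝ) + 1) * x i ≤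
      ∑ i : Fin (k + 1), (((i : ℕ) : ℝ) + 1) * y i := by
    obtain ⟨x, hx, hmax⟩ := (hP.of_isFace hF).isCompact.exists_isMaxOn hF.1 l.continuous.continuousOn
    refine ⟨x, hx, fun y hy => ?_⟩
    have := hmax hy
    simp only [mem_ofPred_eq, hlapp] at this
    linarith
  obtain ⟨haF, hmin⟩ : standardSimplexApex k F ∈ F ∧ ∀ y ∈ F, _ ≤ _ := Classical.epsilon_spec hex
  set a := standardSimplexApex k F with ha
  have hmax : ∀ y ∈ F, l y ≤ l a := fun y hy => by
    rw [hlapp, hlapp]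
    exact neg_le_neg (hmin y hy)
  have hM := isFace_setOf_maximal l haF hmax
  have hMs := IsFace.eq_convexHull_inter hfin (hF.trans hP hM)
  set M := {z ∈ F | ∀ y ∈ F, l y ≤ l z} with hMdef
  have hsub : ((Set.range fun i : Fin (k + 1) => EuclideanSpace.single i (1 : ℝ)) ∩
      M).Subsingleton := by
    rintro _ ⟨⟨i, rfl⟩, hi⟩ _ ⟨⟨j, rfl⟩, hj⟩
    have := le_antisymm (hj.2 _ hi.1) (hi.2 _ hj.1)
    simp [hlapp, Fin.val_inj] at this
    rw [this]
  have haM : a ∈ M := ⟨haF, hmax⟩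
  have hne : ((Set.range fun i : Fin (k + 1) => EuclideanSpace.single i (1 : ℝ)) ∩
      M).Nonempty := by
    rw [← convexHull_nonempty_iff (𝕜 := ℝ), ← hMs]
    exact ⟨a, haM⟩
  obtain ⟨b, hb⟩ := (Set.exists_eq_singleton_iff_nonempty_subsingleton).2 ⟨hne, hsub⟩
  rw [hb, convexHull_singleton] at hMs
  have hab : a = b := by rw [hMs] at haM; exact haM
  rw [hMs, ← hab] at hM
  exact hM.2.isExtreme.mem_extremePoints

theorem polytopeNumber_standardSimplex (k m : ℕ) :
    polytopeNumber (standardSimplexApex k) (standardSimplex k) (m + 1) =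
      ((m + k).choose k : ℤ) := by
  have hs : standardSimplex k = convexHull ℝ (standardVertices k : Set _) := by
    rw [coe_standardVertices, standardSimplex]
  rw [hs]
  refine polytopeNumber_simplex (affineIndependent_standardVertices k)
    (by simp [standardVertices]) (fun F hF => ?_) m
  exact standardSimplexApex_mem_extremePoints k (hs ▸ hF)

/-- For `m < k` the truncation by `toNat` gives the argument 0, in agreement with the vanishing
binomial coefficient. -/
theorem simplexNumber_sub (k m : ℕ) :
    simplexNumber k (((m + 1 : ℕ) : ℤ) - (k : ℤ)) = (m.choose k : ℤ) := by
  unfold simplexNumber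
  rcases lt_or_ge m k with h | h
  · rw [Nat.choose_eq_zero_of_lt h, show (((m + 1 : ℕ) : ℤ) - (k : ℤ)).toNat = 0 by omega,
      polytopeNumber, Nat.cast_zero]
  · obtain ⟨j, rfl⟩ := Nat.exists_eq_add_of_le h
    rw [show (((k + j + 1 : ℕ) : ℤ) - (k : ℤ)).toNat = j + 1 by omega,
      polytopeNumber_standardSimplex, add_comm]

end StandardSimplex

-- Grouping by dimension.

section Decomposition

open scoped Classical

variable {E : Type*} [NormedAddCommGroup E] [NormedSpace ℝ E] [FiniteDimensional ℝ E]

/-- The decomposition theorem for pointed triangulations. -/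
theorem IsPointedTriangulation.polytopeNumber_eq_sum {P : Set E} {C : SimplicialComplex ℝ E}
    {v : Set E → E} (hC : IsPointedTriangulation P C v) (hP : IsPolytope P) (hne : P.Nonempty)
    (n : ℕ) : polytopeNumber v P n = ∑ k ∈ Finset.range (dim P + 1),
      ((simplicesThrough C (v P) k).ncard : ℤ) * simplexNumber k ((n : ℤ) - (k : ℤ)) := by
  rcases n with _ | m
  · rw [polytopeNumber, Finset.sum_eq_zero]
    intro k _
    rw [simplexNumber, show ((0 : ℕ) - (k : ℤ)).toNat = 0 by omega,
      polytopeNumber, mul_zero]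
  have hPs : ∀ t ∈ C.faces, convexHull ℝ (t : Set E) ⊆ P := fun t ht =>
    hC.space_eq ▸ C.convexHull_subset_space ht
  have hv := hC.apex_mem_vertices P (IsFace.refl hne)
  rw [hC.isApexTriangulation.polytopeNumber_succ hP hne (T := hC.finite.toFinset) (fun t => by
    rw [Set.Finite.mem_toFinset]
    exact ⟨fun ht => ⟨ht, hPs t ht⟩, fun ht => ht.1⟩)]
  have hcard : ∀ t ∈ C.faces, 0 < t.card ∧ t.card ≤ dim P + 1 := by
    intro t ht
    have htne := C.nonempty_of_mem_faces ht
    have h1 := dim_add_one_of_affineIndependent htne (C.indep ht)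
    have h2 : dim (t : Set E) ≤ dim P :=
      Submodule.finrank_mono (vectorSpan_mono ℝ ((subset_convexHull ℝ _).trans (hPs t ht)))
    exact ⟨htne.card_pos, by omega⟩
  -- The weight depends only on the dimension `t.card - 1`, and simplices are nonempty, so the
  -- subtraction loses nothing.
  rw [← Finset.sum_fiberwise_of_maps_to (g := fun t => t.card - 1)
    (t := Finset.range (dim P + 1)) (fun t ht => by
      have := hcard t (by simpa using (Finset.mem_filter.1 ht).1)
      simp only [Finset.mem_range]
      omega)]
  refine Finset.sum_congr rfl fun k _ => ?_
  rw [simplexNumber_sub, Finset.sum_congr rfl (g := fun _ => (m.choose k : ℤ))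
    (fun t ht => by rw [(Finset.mem_filter.1 ht).2]), Finset.sum_const, nsmul_eq_mul]
  congr 2
  rw [← Set.ncard_coe_finset]
  congr 1
  ext t
  simp only [Finset.coe_filter, Finset.mem_filter, Set.Finite.mem_toFinset, mem_ofPred_eq,
    simplicesThrough]
  constructor
  · rintro ⟨⟨ht, hvt⟩, hc⟩
    have := hcard t ht
    exact ⟨ht, by omega, subset_convexHull ℝ _ hvt⟩
  · rintro ⟨ht, hc, hvt⟩
    exact ⟨⟨ht, mem_of_mem_extremePoints hv (hPs t ht) hvt⟩, by omega⟩

end Decomposition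

end PolytopeNumbers

theorem mainTheorem8 {e : ℕ} (P : Set (EuclideanSpace ℝ (Fin e)))
    (hP : PolytopeNumbers.IsPolytope P) (hne : P.Nonempty)
    (C : Geometry.SimplicialComplex ℝ (EuclideanSpace ℝ (Fin e)))
    (v : Set (EuclideanSpace ℝ (Fin e)) → EuclideanSpace ℝ (Fin e))
    (hC : PolytopeNumbers.IsPointedTriangulation P C v) (n : ℕ) :
    PolytopeNumbers.polytopeNumber v P n =
      ∑ k ∈ Finset.range (PolytopeNumbers.dim P + 1),
        ((PolytopeNumbers.simplicesThrough C (v P) k).ncard : ℤ) *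
          PolytopeNumbers.simplexNumber k ((n : ℤ) - (k : ℤ)) :=
  hC.polytopeNumber_eq_sum hP hne n
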